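/- Let $U$ be a compact connected Lie group with Lie algebra $\mathfrak u=T_1U$, let $(\cdot\,|\,\cdot)$ be an $\mathrm{Ad}$-invariant Euclidean scalar product on $\mathfrak u$, let $\theta^L_u(\xi)=u^{-1}.\xi$ and $\theta^R_u(\xi)=\xi.u^{-1}$ be the Maurer--Cartan forms, and let $\chi$ be the left-invariant $3$-form on $U$ with $\chi_1(X,Y,Z)=\tfrac12(X\,|\,[Y,Z])$. A quasi-Hamiltonian $U$-space $(M,\omega,\mu)$ is a manifold $M$ with a smooth $U$-action, a smooth $U$-invariant $2$-form $\omega$ and a smooth map $\mu:M\to U$ such that $\mu(u.x)=u\mu(x)u^{-1}$, $d\omega=-\mu^*\chi$, $\ker\omega_x=\{X^\sharp_x : X\in\mathfrak u,\ \mathrm{Ad}\,\mu(x).X=-X\}$ for all $x\in M$, and $\omega(X^\sharp,\cdot)=\tfrac12\,\mu^*(\theta^L+\theta^R\,|\,X)$ for all $X\in\mathfrak u$, where $X^\sharp_x=\tfrac{d}{dt}|_{t=0}\exp(tX).x$ (the exterior derivative being normalized so that $d\omega(X,Y,Z)$ is the cyclic sum of $X(\omega(Y,Z))-\omega([X,Y],Z)$).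 Let $(M_1,\omega_1,\mu_1)$ and $(M_2,\omega_2,\mu_2)$ be two quasi-Hamiltonian $U$-spaces. Let $\tau$ be an involutive automorphism of the Lie group $U$ whose tangent map $T_1\tau$ is an isometry of $(\mathfrak u,(\cdot\,|\,\cdot))$, and put $\tau^-(u)=\tau(u^{-1})$. For $i=1,2$ let $\beta_i$ be a smooth involution on $M_i$ ($\beta_i\circ\beta_i=\mathrm{Id}$) such that (i) $\beta_i^*\omega_i=-\omega_i$; (ii) $\beta_i(u.x)=\tau(u).\beta_i(x)$ for all $u\in U$ and $x\in M_i$; (iii) $\mu_i\circ\beta_i=\tau^-\circ\mu_i$. Endow $M=M_1\times M_2$ with the diagonal action of $U$, the map $\mu(x_1,x_2)=\mu_1(x_1)\mu_2(x_2)$ and the fusion form $\omega=(\omega_1\oplus\omega_2)+(\mu_1^*\theta^L\wedge\mu_2^*\theta^R)$, where $$(\mu_1^*\theta^L\wedge\mu_2^*\theta^R)\big((v_1,v_2),(w_1,w_2)\big)=\tfrac12\Big(\big(\mu_1^*\theta^L(v_1)\,|\,\mu_2^*\theta^R(w_2)\big)-\big(\mu_1^*\theta^L(w_1)\,|\,\mu_2^*\theta^R(v_2)\big)\Big).$$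 Then the map $\beta:M\to M$, $$\beta(x_1,x_2)=\big(\mu_2(\beta_2(x_2)).\beta_1(x_1),\ \beta_2(x_2)\big),$$ is a smooth involution on $M$ such that (i) $\beta^*\omega=-\omega$; (ii) $\beta(u.x)=\tau(u).\beta(x)$ for all $u\in U$ and $x\in M$; (iii) $\mu\circ\beta=\tau^-\circ\mu$. -/

import Mathlib

open Set
open scoped Manifold ContDiff

noncomputable section

namespace QuasiHam

section Forms

variable {E : Type*} [NormedAddCommGroup E] [NormedSpace ℝ E]
  {H : Type*} [TopologicalSpace H] (I : ModelWithCorners ℝ E H)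
  {E' : Type*} [NormedAddCommGroup E'] [NormedSpace ℝ E']
  {H' : Type*} [TopologicalSpace H'] (I' : ModelWithCorners ℝ E' H')
  {M : Type*} [TopologicalSpace M] [ChartedSpace H M]
  {N : Type*} [TopologicalSpace N] [ChartedSpace H' N]

/-- A (not necessarily smooth) real differential `k`-form on the manifold `M`. -/
abbrev DiffForm (M : Type*) [TopologicalSpace M] [ChartedSpace H M] (k : ℕ) : Type _ :=
  ∀ x : M, TangentSpace I x [⋀^Fin k]→L[ℝ] ℝ

/-- The pull-back `f^* Ω` of a differential form `Ω` along `f : M → N`. -/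
def pullback {k : ℕ} (f : M → N) (Ω : DiffForm I' N k) : DiffForm I M k :=
  fun x => (Ω (f x)).compContinuousLinearMap (mfderiv I I' f x)

/-- The expression of a differential form in the chart around `x₀`: its pull-back under the
inverse of that chart, a form on the chart's image in the model space. -/
def inChart {k : ℕ} (Ω : DiffForm I M k) (x₀ : M) : E → E [⋀^Fin k]→L[ℝ] ℝ :=
  fun y => (Ω ((extChartAt I x₀).symm y)).compContinuousLinearMap
    (mfderivWithin 𝓘(ℝ, E) I (extChartAt I x₀).symm (range I) y)

/-- A differential form is smooth if its expressions in the charts are. -/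
def IsSmoothForm {k : ℕ} (Ω : DiffForm I M k) : Prop :=
  ∀ x₀ : M, ContDiffOn ℝ ∞ (inChart I Ω x₀) (extChartAt I x₀).target

/-- The exterior derivative of a differential form, computed at `x` in the chart around `x`,
with the normalization
`dΩ(X₀, …, Xₖ) = ∑ (-1)^i Xᵢ(Ω(…, X̂ᵢ, …)) + ∑_{i<j} (-1)^(i+j) Ω([Xᵢ, Xⱼ], …)`. -/
def extD {k : ℕ} (Ω : DiffForm I M k) : DiffForm I M (k + 1) :=
  fun x => (extDerivWithin (inChart I Ω x) (range I) (extChartAt I x x)).compContinuousLinearMap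
    (mfderiv I 𝓘(ℝ, E) (extChartAt I x) x)

end Forms

section Wedge

variable {V : Type*} [AddCommGroup V] [Module ℝ V] [TopologicalSpace V]
  {W : Type*} [NormedAddCommGroup W] [NormedSpace ℝ W]

/-- The alternating form `(v, w) ↦ ½ (B (a v) (c w) - B (a w) (c v))`. -/
def wedgePairing (B : W →L[ℝ] W →L[ℝ] ℝ) (a c : V →L[ℝ] W) : V [⋀^Fin 2]→L[ℝ] ℝ where
  toFun v := (1 / 2 : ℝ) * (B (a (v 0)) (c (v 1)) - B (a (v 1)) (c (v 0)))
  map_update_add' := by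
    intro _ v i x y
    fin_cases i <;> simp [Function.update] <;> ring
  map_update_smul' := by
    intro _ v i r x
    fin_cases i <;> simp [Function.update] <;> ring
  map_eq_zero_of_eq' := by
    intro v i j hv hij
    fin_cases i <;> fin_cases j <;> simp_all
  cont := by fun_prop

end Wedge

section LieGroups

variable {E : Type*} [NormedAddCommGroup E] [NormedSpace ℝ E]
  {H : Type*} [TopologicalSpace H] (I : ModelWithCorners ℝ E H)
  {U : Type*} [TopologicalSpace U] [ChartedSpace H U] [Group U]

/-- The left-invariant Maurer-Cartan form: `θ^L_u(ξ) = u⁻¹ . ξ`. -/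
def thetaL (u : U) : TangentSpace I u →L[ℝ] GroupLieAlgebra I U :=
  mfderiv I I (fun h : U => u⁻¹ * h) u

/-- The right-invariant Maurer-Cartan form: `θ^R_u(ξ) = ξ . u⁻¹`. -/
def thetaR (u : U) : TangentSpace I u →L[ℝ] GroupLieAlgebra I U :=
  mfderiv I I (fun h : U => h * u⁻¹) u

/-- The adjoint action of `u` on the Lie algebra: the tangent map at `1` of conjugation by `u`. -/
def Ad (u : U) : GroupLieAlgebra I U →L[ℝ] GroupLieAlgebra I U :=
  mfderiv I I (fun h : U => u * h * u⁻¹) 1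

/-- The tangent map at `1` of a group automorphism, an endomorphism of the Lie algebra. -/
def tangentOne (τ : U ≃* U) : GroupLieAlgebra I U →L[ℝ] GroupLieAlgebra I U :=
  mfderiv I I (fun h : U => τ h) 1

/-- `B` is an `Ad`-invariant Euclidean scalar product on the Lie algebra of `U`. -/
structure IsAdInvariantEuclidean
    (B : GroupLieAlgebra I U →L[ℝ] GroupLieAlgebra I U →L[ℝ] ℝ) : Prop where
  symm : ∀ X Y, B X Y = B Y X
  pos : ∀ X, X ≠ 0 → 0 < B X X
  ad_invariant : ∀ (u : U) (X Y), B (Ad I u X) (Ad I u Y) = B X Y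

/-- `τ` is an involutive automorphism of the Lie group `U` endowed with the scalar product `B` on
its Lie algebra, i.e. an involutive smooth automorphism whose tangent map at `1` is an isometry. -/
structure IsInvolutiveAutomorphism
    (B : GroupLieAlgebra I U →L[ℝ] GroupLieAlgebra I U →L[ℝ] ℝ) (τ : U ≃* U) : Prop where
  smooth : ContMDiff I I ∞ (fun u : U => τ u)
  involutive : ∀ u, τ (τ u) = u
  isometry : ∀ X Y, B (tangentOne I τ X) (tangentOne I τ Y) = B X Y

/-- Half the Cartan `3`-form of `U`: the left-invariant form with
`χ_1(X, Y, Z) = ½ (X | [Y, Z])`. -/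
def cartan (B : GroupLieAlgebra I U →L[ℝ] GroupLieAlgebra I U →L[ℝ] ℝ)
    (u : U) (ξ η ζ : TangentSpace I u) : ℝ :=
  (1 / 2 : ℝ) * B (thetaL I u ξ) ⁅thetaL I u η, thetaL I u ζ⁆

end LieGroups

section QHam

variable {E : Type*} [NormedAddCommGroup E] [NormedSpace ℝ E]
  {H : Type*} [TopologicalSpace H] (I : ModelWithCorners ℝ E H)
  {U : Type*} [TopologicalSpace U] [ChartedSpace H U] [Group U]
  {F : Type*} [NormedAddCommGroup F] [NormedSpace ℝ F]
  {K : Type*} [TopologicalSpace K] (J : ModelWithCorners ℝ F K)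
  {M : Type*} [TopologicalSpace M] [ChartedSpace K M] [MulAction U M]

/-- The value at `x` of the fundamental vector field of `X`, i.e. `d/dt|_{t=0} (exp(tX) . x)`,
written as the tangent map at `1` of the orbit map `u ↦ u . x` applied to `X`. -/
def fundamentalField (x : M) : GroupLieAlgebra I U →L[ℝ] TangentSpace J x :=
  mfderiv I J (fun u : U => u • x) 1

/-- `(M, Ω, μ)` is a quasi-Hamiltonian `U`-space. -/
structure IsQuasiHamiltonian (B : GroupLieAlgebra I U →L[ℝ] GroupLieAlgebra I U →L[ℝ] ℝ)
    (Ω : DiffForm J M 2) (μ : M → U) : Prop where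
  smooth_form : IsSmoothForm J Ω
  smooth_momentum : ContMDiff J I ∞ μ
  invariant : ∀ u : U, pullback J J (fun x : M => u • x) Ω = Ω
  equivariant : ∀ (u : U) (x : M), μ (u • x) = u * μ x * u⁻¹
  extD_form : ∀ (x : M) (v₀ v₁ v₂ : TangentSpace J x),
    extD J Ω x ![v₀, v₁, v₂] =
      -cartan I B (μ x) (mfderiv J I μ x v₀) (mfderiv J I μ x v₁) (mfderiv J I μ x v₂)
  ker_form : ∀ x : M, {v : TangentSpace J x | ∀ w : TangentSpace J x, Ω x ![v, w] = 0} =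
    {v | ∃ X : GroupLieAlgebra I U, Ad I (μ x) X = -X ∧ v = fundamentalField I J x X}
  momentum : ∀ (X : GroupLieAlgebra I U) (x : M) (v : TangentSpace J x),
    Ω x ![fundamentalField I J x X, v] =
      (1 / 2 : ℝ) * B (thetaL I (μ x) (mfderiv J I μ x v) + thetaR I (μ x) (mfderiv J I μ x v)) X

/-- `β` is a (smooth) involution of `M` which reverses the `2`-form `Ω` and is compatible, with
respect to `τ`, with the action of `U` and with the momentum map `μ`
(where `τ⁻(u) = τ(u⁻¹)`). -/
structure IsReversingInvolution (τ : U ≃* U) (Ω : DiffForm J M 2) (μ : M → U) (β : M → M) :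
    Prop where
  smooth : ContMDiff J J ∞ β
  involutive : ∀ x, β (β x) = x
  reverses : pullback J J β Ω = -Ω
  action : ∀ (u : U) (x : M), β (u • x) = τ u • β x
  momentum : ∀ x, μ (β x) = τ ((μ x)⁻¹)

end QHam

section Fusion

variable {E : Type*} [NormedAddCommGroup E] [NormedSpace ℝ E]
  {H : Type*} [TopologicalSpace H] (I : ModelWithCorners ℝ E H)
  {U : Type*} [TopologicalSpace U] [ChartedSpace H U] [Group U]
  {F₁ : Type*} [NormedAddCommGroup F₁] [NormedSpace ℝ F₁]
  {K₁ : Type*} [TopologicalSpace K₁] (J₁ : ModelWithCorners ℝ F₁ K₁)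
  {M₁ : Type*} [TopologicalSpace M₁] [ChartedSpace K₁ M₁]
  {F₂ : Type*} [NormedAddCommGroup F₂] [NormedSpace ℝ F₂]
  {K₂ : Type*} [TopologicalSpace K₂] (J₂ : ModelWithCorners ℝ F₂ K₂)
  {M₂ : Type*} [TopologicalSpace M₂] [ChartedSpace K₂ M₂]

/-- The fusion form `(Ω₁ ⊕ Ω₂) + (μ₁^* θ^L ∧ μ₂^* θ^R)` on `M₁ × M₂`. -/
def fusionForm (B : GroupLieAlgebra I U →L[ℝ] GroupLieAlgebra I U →L[ℝ] ℝ)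
    (Ω₁ : DiffForm J₁ M₁ 2) (μ₁ : M₁ → U) (Ω₂ : DiffForm J₂ M₂ 2) (μ₂ : M₂ → U) :
    DiffForm (J₁.prod J₂) (M₁ × M₂) 2 :=
  fun p => pullback (J₁.prod J₂) J₁ Prod.fst Ω₁ p + pullback (J₁.prod J₂) J₂ Prod.snd Ω₂ p +
    wedgePairing (W := E) B
      ((thetaL I (μ₁ p.1)).comp
        ((mfderiv J₁ I μ₁ p.1).comp (mfderiv (J₁.prod J₂) J₁ Prod.fst p)))
      ((thetaR I (μ₂ p.2)).comp
        ((mfderiv J₂ I μ₂ p.2).comp (mfderiv (J₁.prod J₂) J₂ Prod.snd p)))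

/-- The momentum map `μ₁ · μ₂` of the fusion product. -/
def fusionMomentum (μ₁ : M₁ → U) (μ₂ : M₂ → U) : M₁ × M₂ → U :=
  fun p => μ₁ p.1 * μ₂ p.2

/-- The map `(x₁, x₂) ↦ ((μ₂ ∘ β₂(x₂)) . β₁(x₁), β₂(x₂))`. -/
def fusionInvolution [MulAction U M₁] (μ₂ : M₂ → U) (β₁ : M₁ → M₁) (β₂ : M₂ → M₂) :
    M₁ × M₂ → M₁ × M₂ :=
  fun p => (μ₂ (β₂ p.2) • β₁ p.1, β₂ p.2)

end Fusion

end QuasiHam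

end

/-!
The involution factors as `β = R ∘ S`, with `S (x₁, x₂) = (β₂(x₂), β₁(x₁))` and with the braiding
`R (x₂, x₁) = (μ₂(x₂) . x₁, x₂)` from `M₂ × M₁` to `M₁ × M₂`.

The braiding pulls the fusion form of `M₁ × M₂` back to that of `M₂ × M₁`: differentiating the
action, the first component of `dR (v₂, v₁)` is `μ₂(x₂) . (ξ^♯ + v₁)` with `ξ = μ₂^* θ^L (v₂)`, and
by the momentum condition for `μ₁` and `Ad`-invariance the terms containing `ξ^♯` exactly exchange
`θ^L` and `θ^R` in the mixed part. The map `S` then reverses the fusion form, because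
`μᵢ ∘ βᵢ = τ⁻ ∘ μᵢ` turns `θ^L` into `-dτ θ^R` and vice versa.
-/

noncomputable section

namespace QuasiHam

section TwoForms

variable {V : Type*} [AddCommGroup V] [Module ℝ V] [TopologicalSpace V]

theorem twoForm_swap (η : V [⋀^Fin 2]→L[ℝ] ℝ) (v w : V) : η ![w, v] = -η ![v, w] := by
  have swap_eq : ![v, w] ∘ Equiv.swap 0 1 = ![w, v] := by
    ext i; fin_cases i <;> rfl
  rw [← swap_eq]
  exact η.map_swap ![v, w] (by decide)

theorem twoForm_add_add (η : V [⋀^Fin 2]→L[ℝ] ℝ) (a b v w : V) :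
    η ![a + v, b + w] = η ![a, b] + η ![a, w] - η ![b, v] + η ![v, w] := by
  have add_left (x y z : V) : η ![x + y, z] = η ![x, z] + η ![y, z] := η.vecCons_add ![z] x y
  have add_right (x y z : V) : η ![x, y + z] = η ![x, y] + η ![x, z] := by
    rw [twoForm_swap, add_left, twoForm_swap η x, twoForm_swap η x]; ring
  rw [add_left, add_right, add_right, twoForm_swap η b v]
  ring

end TwoForms

section Pullback

variable {E : Type*} [NormedAddCommGroup E] [NormedSpace ℝ E]
  {H : Type*} [TopologicalSpace H] {I : ModelWithCorners ℝ E H}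
  {E' : Type*} [NormedAddCommGroup E'] [NormedSpace ℝ E']
  {H' : Type*} [TopologicalSpace H'] {I' : ModelWithCorners ℝ E' H'}
  {E'' : Type*} [NormedAddCommGroup E''] [NormedSpace ℝ E'']
  {H'' : Type*} [TopologicalSpace H''] {I'' : ModelWithCorners ℝ E'' H''}
  {M : Type*} [TopologicalSpace M] [ChartedSpace H M]
  {N : Type*} [TopologicalSpace N] [ChartedSpace H' N]
  {P : Type*} [TopologicalSpace P] [ChartedSpace H'' P]

theorem DiffForm.ext_two {Ω Ω' : DiffForm I M 2}
    (h : ∀ (x : M) (v w : TangentSpace I x), Ω x ![v, w] = Ω' x ![v, w]) : Ω = Ω' := by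
  funext x
  ext v
  have v_eq : v = ![v 0, v 1] := by ext i; fin_cases i <;> rfl
  rw [v_eq, h]

theorem pullback_apply_two (f : M → N) (Ω : DiffForm I' N 2) (x : M) (v w : TangentSpace I x) :
    pullback I I' f Ω x ![v, w] = Ω (f x) ![mfderiv I I' f x v, mfderiv I I' f x w] := by
  have comp_eq : mfderiv I I' f x ∘ ![v, w] = ![mfderiv I I' f x v, mfderiv I I' f x w] := by
    ext i; fin_cases i <;> rfl
  rw [← comp_eq]
  rfl

theorem pullback_comp {k : ℕ} {g : N → P} {f : M → N} (hg : MDifferentiable I' I'' g)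
    (hf : MDifferentiable I I' f) (Ω : DiffForm I'' P k) :
    pullback I I'' (g ∘ f) Ω = pullback I I' f (pullback I' I'' g Ω) := by
  funext x
  rw [pullback, mfderiv_comp x (hg _) (hf x)]
  rfl

variable {f : M → N} {g : M → P} {x : M} (hf : MDifferentiableAt I I' f x)
  (hg : MDifferentiableAt I I'' g x)
include hf hg

theorem mfderiv_fst_mfderiv_prodMk (v : TangentSpace I x) :
    mfderiv (I'.prod I'') I' Prod.fst (f x, g x)
        (mfderiv I (I'.prod I'') (fun y => (f y, g y)) x v) = mfderiv I I' f x v :=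
  (mfderiv_comp_apply x mdifferentiableAt_fst (hf.prodMk hg) v).symm

theorem mfderiv_snd_mfderiv_prodMk (v : TangentSpace I x) :
    mfderiv (I'.prod I'') I'' Prod.snd (f x, g x)
        (mfderiv I (I'.prod I'') (fun y => (f y, g y)) x v) = mfderiv I I'' g x v :=
  (mfderiv_comp_apply x mdifferentiableAt_snd (hf.prodMk hg) v).symm

end Pullback

section LieGroup

variable {E : Type*} [NormedAddCommGroup E] [NormedSpace ℝ E]
  {H : Type*} [TopologicalSpace H] {I : ModelWithCorners ℝ E H}
  {U : Type*} [TopologicalSpace U] [ChartedSpace H U] [Group U]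

theorem Ad_one : Ad I (1 : U) = ContinuousLinearMap.id ℝ _ := by
  have conj_one : (fun u : U => 1 * u * 1⁻¹) = id := by funext u; simp
  rw [Ad, conj_one]
  exact mfderiv_id

variable [LieGroup I 1 U]

theorem mdifferentiable_mul_left (a : U) : MDifferentiable I I (fun u : U => a * u) :=
  (contMDiff_mul_left (n := 1)).mdifferentiable one_ne_zero

theorem mdifferentiable_mul_right (b : U) : MDifferentiable I I (fun u : U => u * b) :=
  (contMDiff_mul_right (n := 1)).mdifferentiable one_ne_zero

theorem mdifferentiable_conj (a : U) : MDifferentiable I I (fun u : U => a * u * a⁻¹) :=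
  (mdifferentiable_mul_right a⁻¹).comp (mdifferentiable_mul_left a)

theorem Ad_mul (a b : U) : Ad I (a * b) = (Ad I a).comp (Ad I b) := by
  have conj_mul : (fun u : U => a * b * u * (a * b)⁻¹) =
      (fun u => a * u * a⁻¹) ∘ (fun u => b * u * b⁻¹) := by
    funext u; simp [mul_assoc]
  ext X
  rw [Ad, conj_mul]
  exact mfderiv_comp_apply_of_eq 1 (mdifferentiable_conj a 1) (mdifferentiable_conj b 1)
    (by simp) X

theorem Ad_inv_apply_Ad_apply (a : U) (X : GroupLieAlgebra I U) : Ad I a⁻¹ (Ad I a X) = X := by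
  rw [← ContinuousLinearMap.comp_apply, ← Ad_mul, inv_mul_cancel, Ad_one,
    ContinuousLinearMap.id_apply]

theorem thetaR_apply (u : U) (ξ : TangentSpace I u) : thetaR I u ξ = Ad I u (thetaL I u ξ) := by
  have comp_eq : (fun h : U => h * u⁻¹) = (fun h => u * h * u⁻¹) ∘ (fun h => u⁻¹ * h) := by
    funext h; simp
  rw [thetaR, comp_eq]
  exact mfderiv_comp_apply_of_eq u (mdifferentiable_conj u 1) (mdifferentiable_mul_left u⁻¹ u)
    (inv_mul_cancel u) ξ

theorem thetaL_mul_left (a u : U) (ξ : TangentSpace I u) :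
    thetaL I (a * u) (mfderiv I I (fun h => a * h) u ξ) = thetaL I u ξ := by
  have comp_eq : (fun h : U => u⁻¹ * h) = (fun h => (a * u)⁻¹ * h) ∘ (fun h => a * h) := by
    funext h; simp [mul_assoc]
  rw [thetaL, thetaL, comp_eq]
  exact (mfderiv_comp_apply u (mdifferentiable_mul_left _ _) (mdifferentiable_mul_left a u) ξ).symm

theorem thetaL_mul_right (u b : U) (ξ : TangentSpace I u) :
    thetaL I (u * b) (mfderiv I I (fun h => h * b) u ξ) = Ad I b⁻¹ (thetaL I u ξ) := by
  have comp_eq : (fun h : U => (u * b)⁻¹ * h) ∘ (fun h => h * b) =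
      (fun h => b⁻¹ * h * b⁻¹⁻¹) ∘ (fun h => u⁻¹ * h) := by
    funext h; simp [mul_assoc]
  have deriv_eq := mfderiv_comp_apply_of_eq u (mdifferentiable_conj (I := I) b⁻¹ 1)
    (mdifferentiable_mul_left u⁻¹ u) (inv_mul_cancel u) ξ
  rw [← comp_eq] at deriv_eq
  exact (mfderiv_comp_apply u (mdifferentiable_mul_left _ _)
    (mdifferentiable_mul_right b u) ξ).symm.trans deriv_eq

theorem thetaL_map {τ : U ≃* U} (hτ : MDifferentiable I I τ) (u : U) (ξ : TangentSpace I u) :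
    thetaL I (τ u) (mfderiv I I τ u ξ) = tangentOne I τ (thetaL I u ξ) := by
  have comp_eq : (fun h : U => (τ u)⁻¹ * h) ∘ τ = τ ∘ (fun h => u⁻¹ * h) := by
    funext h; simp
  have deriv_eq := mfderiv_comp_apply_of_eq u (hτ 1) (mdifferentiable_mul_left u⁻¹ u)
    (inv_mul_cancel u) ξ
  rw [← comp_eq] at deriv_eq
  exact (mfderiv_comp_apply u (mdifferentiable_mul_left _ _) (hτ u) ξ).symm.trans deriv_eq

theorem thetaR_map {τ : U ≃* U} (hτ : MDifferentiable I I τ) (u : U) (ξ : TangentSpace I u) :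
    thetaR I (τ u) (mfderiv I I τ u ξ) = tangentOne I τ (thetaR I u ξ) := by
  have comp_eq : (fun h : U => h * (τ u)⁻¹) ∘ τ = τ ∘ (fun h => h * u⁻¹) := by
    funext h; simp
  have deriv_eq := mfderiv_comp_apply_of_eq u (hτ 1) (mdifferentiable_mul_right u⁻¹ u)
    (mul_inv_cancel u) ξ
  rw [← comp_eq] at deriv_eq
  exact (mfderiv_comp_apply u (mdifferentiable_mul_right _ _) (hτ u) ξ).symm.trans deriv_eq

end LieGroup

section Action

variable {E : Type*} [NormedAddCommGroup E] [NormedSpace ℝ E]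
  {H : Type*} [TopologicalSpace H] {I : ModelWithCorners ℝ E H}
  {U : Type*} [TopologicalSpace U] [ChartedSpace H U] [Group U]
  {F : Type*} [NormedAddCommGroup F] [NormedSpace ℝ F]
  {K : Type*} [TopologicalSpace K] {J : ModelWithCorners ℝ F K}
  {M : Type*} [TopologicalSpace M] [ChartedSpace K M] [MulAction U M]
  {F' : Type*} [NormedAddCommGroup F'] [NormedSpace ℝ F']
  {K' : Type*} [TopologicalSpace K'] {J' : ModelWithCorners ℝ F' K'}
  {N : Type*} [TopologicalSpace N] [ChartedSpace K' N]

variable (I) in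
theorem mdifferentiable_const_smul [ContMDiffSMul I J 1 U M] (u : U) :
    MDifferentiable J J (fun x : M => u • x) :=
  (ContMDiffSMul.contMDiff_const_smul (I := I) (n := 1) u).mdifferentiable one_ne_zero

variable [ContMDiffSMul I J 1 U M]

theorem mdifferentiable_smul : MDifferentiable (I.prod J) J (fun p : U × M => p.1 • p.2) :=
  contMDiff_smul.mdifferentiable one_ne_zero

variable (I J) in
theorem mdifferentiable_orbit (x : M) : MDifferentiable I J (fun u : U => u • x) :=
  mdifferentiable_smul.comp (I' := I.prod J) (mdifferentiable_id.prodMk mdifferentiable_const)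

theorem mfderiv_smul_apply {f : N → U} {g : N → M} {x : N} (hf : MDifferentiableAt J' I f x)
    (hg : MDifferentiableAt J' J g x) (v : TangentSpace J' x) :
    mfderiv J' J (fun z => f z • g z) x v =
      mfderiv I J (fun u => u • g x) (f x) (mfderiv J' I f x v) +
        mfderiv J J (fun y => f x • y) (g x) (mfderiv J' J g x v) := by
  have smul_diff := mdifferentiable_smul (I := I) (J := J) (f x, g x)
  have chain := mfderiv_comp_apply x smul_diff (hf.prodMk hg) v
  rw [mfderiv_prodMk hf hg, mfderiv_prod_eq_add_apply smul_diff] at chain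
  exact chain

theorem mfderiv_orbit_apply [LieGroup I 1 U] (u : U) (x : M) (ξ : TangentSpace I u) :
    mfderiv I J (fun h : U => h • x) u ξ =
      mfderiv J J (fun y => u • y) x (fundamentalField I J x (thetaL I u ξ)) := by
  have comp_eq : (fun h : U => h • x) =
      (fun y => u • y) ∘ (fun h => h • x) ∘ (fun h => u⁻¹ * h) := by
    funext h; simp [smul_smul]
  have mul_diff := mdifferentiable_mul_left (I := I) u⁻¹ u
  have orbit_diff := mdifferentiable_orbit I J x (1 : U)
  have orbit_mul_diff : MDifferentiableAt I J ((fun h : U => h • x) ∘ (fun h => u⁻¹ * h)) u :=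
    orbit_diff.comp_of_eq u mul_diff (inv_mul_cancel u)
  have outer := mfderiv_comp_apply_of_eq u (mdifferentiable_const_smul I u x) orbit_mul_diff
    (by simp) ξ
  have inner := mfderiv_comp_apply_of_eq u orbit_diff mul_diff (inv_mul_cancel u) ξ
  rw [← comp_eq] at outer
  exact outer.trans (congrArg (mfderiv J J (fun y => u • y) x) inner)

end Action

section LogDeriv

variable {E : Type*} [NormedAddCommGroup E] [NormedSpace ℝ E]
  {H : Type*} [TopologicalSpace H] (I : ModelWithCorners ℝ E H)
  {U : Type*} [TopologicalSpace U] [ChartedSpace H U] [Group U]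
  {F' : Type*} [NormedAddCommGroup F'] [NormedSpace ℝ F']
  {K' : Type*} [TopologicalSpace K'] {J' : ModelWithCorners ℝ F' K'}
  {N : Type*} [TopologicalSpace N] [ChartedSpace K' N]
  {F : Type*} [NormedAddCommGroup F] [NormedSpace ℝ F]
  {K : Type*} [TopologicalSpace K] (J : ModelWithCorners ℝ F K)
  {M : Type*} [TopologicalSpace M] [ChartedSpace K M]

/-- The left logarithmic derivative `f⁻¹ df = f^* θ^L` of a map `f` into a Lie group. -/
def logDerivL (f : M → U) (x : M) : TangentSpace J x →L[ℝ] GroupLieAlgebra I U :=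
  (thetaL I (f x)).comp (mfderiv J I f x)

/-- The right logarithmic derivative `df f⁻¹ = f^* θ^R` of a map `f` into a Lie group. -/
def logDerivR (f : M → U) (x : M) : TangentSpace J x →L[ℝ] GroupLieAlgebra I U :=
  (thetaR I (f x)).comp (mfderiv J I f x)

variable {I J}

theorem logDerivL_comp_apply {f : M → U} {h : N → M} {x : N} {y : M}
    (hf : MDifferentiableAt J I f y) (hh : MDifferentiableAt J' J h x) (hy : h x = y)
    (v : TangentSpace J' x) :
    logDerivL I J' (f ∘ h) x v = logDerivL I J f y (mfderiv J' J h x v) := by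
  subst hy
  exact congrArg (thetaL I (f (h x))) (mfderiv_comp_apply x hf hh v)

theorem logDerivR_comp_apply {f : M → U} {h : N → M} {x : N}
    (hf : MDifferentiableAt J I f (h x)) (hh : MDifferentiableAt J' J h x)
    (v : TangentSpace J' x) :
    logDerivR I J' (f ∘ h) x v = logDerivR I J f (h x) (mfderiv J' J h x v) :=
  congrArg (thetaR I (f (h x))) (mfderiv_comp_apply x hf hh v)

theorem logDerivL_const (a : U) (x : M) : logDerivL I J (fun _ => a) x = 0 := by
  rw [logDerivL, mfderiv_const, ContinuousLinearMap.comp_zero]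

theorem logDerivL_id_one (X : GroupLieAlgebra I U) : logDerivL I I (fun u : U => u) 1 X = X := by
  have mul_eq : (fun h : U => 1⁻¹ * h) = id := by funext h; simp
  rw [logDerivL, thetaL, mul_eq]
  exact congrArg (fun D => D.comp D X) (mfderiv_id (I := I) (x := (1 : U)))

variable [LieGroup I 1 U] {f g : M → U} {x : M}

theorem logDerivR_apply (f : M → U) (v : TangentSpace J x) :
    logDerivR I J f x v = Ad I (f x) (logDerivL I J f x v) :=
  thetaR_apply (f x) _

theorem logDerivL_mul_apply (hf : MDifferentiableAt J I f x) (hg : MDifferentiableAt J I g x)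
    (v : TangentSpace J x) :
    logDerivL I J (fun z => f z * g z) x v =
      Ad I (g x)⁻¹ (logDerivL I J f x v) + logDerivL I J g x v := by
  have mul_deriv := mfderiv_smul_apply (M := U) hf hg v
  have theta_deriv := congrArg (thetaL I (f x * g x)) mul_deriv
  rw [map_add] at theta_deriv
  exact theta_deriv.trans (congrArg₂ (· + ·) (thetaL_mul_right (f x) (g x) _)
    (thetaL_mul_left (f x) (g x) _))

theorem mdifferentiableAt_inv (hf : MDifferentiableAt J I f x) :
    MDifferentiableAt J I (fun z => (f z)⁻¹) x :=
  ((contMDiff_inv I 1).mdifferentiable one_ne_zero (f x)).comp x hf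

theorem logDerivL_inv_apply (hf : MDifferentiableAt J I f x) (v : TangentSpace J x) :
    logDerivL I J (fun z => (f z)⁻¹) x v = -logDerivR I J f x v := by
  have mul_inv := logDerivL_mul_apply hf (mdifferentiableAt_inv hf) v
  simp only [mul_inv_cancel, logDerivL_const, inv_inv, ← logDerivR_apply] at mul_inv
  exact eq_neg_of_add_eq_zero_right mul_inv.symm

theorem logDerivR_inv_apply (hf : MDifferentiableAt J I f x) (v : TangentSpace J x) :
    logDerivR I J (fun z => (f z)⁻¹) x v = -logDerivL I J f x v := by
  rw [logDerivR_apply, logDerivL_inv_apply hf, map_neg, logDerivR_apply, Ad_inv_apply_Ad_apply]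

theorem logDerivL_conj_apply (hf : MDifferentiableAt J I f x) (a : U) (v : TangentSpace J x) :
    logDerivL I J (fun z => a * f z * a⁻¹) x v = Ad I a (logDerivL I J f x v) := by
  have mul_diff : MDifferentiableAt J I (fun z => a * f z) x :=
    (mdifferentiable_mul_left a (f x)).comp x hf
  rw [logDerivL_mul_apply mul_diff mdifferentiableAt_const,
    logDerivL_mul_apply mdifferentiableAt_const hf]
  simp [logDerivL_const]

theorem logDerivL_map_apply {τ : U ≃* U} (hτ : MDifferentiable I I τ)
    (hf : MDifferentiableAt J I f x) (v : TangentSpace J x) :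
    logDerivL I J (fun z => τ (f z)) x v = tangentOne I τ (logDerivL I J f x v) :=
  (congrArg (thetaL I (τ (f x))) (mfderiv_comp_apply x (hτ (f x)) hf v)).trans
    (thetaL_map hτ (f x) _)

theorem logDerivR_map_apply {τ : U ≃* U} (hτ : MDifferentiable I I τ)
    (hf : MDifferentiableAt J I f x) (v : TangentSpace J x) :
    logDerivR I J (fun z => τ (f z)) x v = tangentOne I τ (logDerivR I J f x v) :=
  (congrArg (thetaR I (τ (f x))) (mfderiv_comp_apply x (hτ (f x)) hf v)).trans
    (thetaR_map hτ (f x) _)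

end LogDeriv

section MomentumMap

variable {E : Type*} [NormedAddCommGroup E] [NormedSpace ℝ E]
  {H : Type*} [TopologicalSpace H] (I : ModelWithCorners ℝ E H)
  {U : Type*} [TopologicalSpace U] [ChartedSpace H U] [Group U]
  {F : Type*} [NormedAddCommGroup F] [NormedSpace ℝ F]
  {K : Type*} [TopologicalSpace K] (J : ModelWithCorners ℝ F K)
  {M : Type*} [TopologicalSpace M] [ChartedSpace K M] [MulAction U M]

/-- `μ` is a group-valued momentum map for the action of `U` on `M` and the invariant `2`-form `Ω`.
Unlike in a quasi-Hamiltonian space, `dΩ` and `ker Ω` are not prescribed, and `μ` need only be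
differentiable. -/
structure IsGroupValuedMomentumMap
    (B : GroupLieAlgebra I U →L[ℝ] GroupLieAlgebra I U →L[ℝ] ℝ)
    (Ω : DiffForm J M 2) (μ : M → U) : Prop where
  mdifferentiable : MDifferentiable J I μ
  invariant : ∀ u : U, pullback J J (fun x : M => u • x) Ω = Ω
  equivariant : ∀ (u : U) (x : M), μ (u • x) = u * μ x * u⁻¹
  momentum : ∀ (X : GroupLieAlgebra I U) (x : M) (v : TangentSpace J x),
    Ω x ![fundamentalField I J x X, v] =
      (1 / 2 : ℝ) * B (logDerivL I J μ x v + logDerivR I J μ x v) X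

variable {I J} {B : GroupLieAlgebra I U →L[ℝ] GroupLieAlgebra I U →L[ℝ] ℝ}
  {Ω : DiffForm J M 2} {μ : M → U}

theorem IsQuasiHamiltonian.isGroupValuedMomentumMap (h : IsQuasiHamiltonian I J B Ω μ) :
    IsGroupValuedMomentumMap I J B Ω μ where
  mdifferentiable := h.smooth_momentum.mdifferentiable (by simp)
  invariant := h.invariant
  equivariant := h.equivariant
  momentum := h.momentum

namespace IsGroupValuedMomentumMap

variable (h : IsGroupValuedMomentumMap I J B Ω μ) [LieGroup I 1 U] [ContMDiffSMul I J 1 U M]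
include h

theorem logDerivL_smul_apply (u : U) (x : M) (v : TangentSpace J x) :
    logDerivL I J μ (u • x) (mfderiv J J (fun y => u • y) x v) = Ad I u (logDerivL I J μ x v) := by
  have comp_eq : μ ∘ (fun y => u • y) = fun y => u * μ y * u⁻¹ := funext (h.equivariant u)
  rw [← logDerivL_comp_apply (h.mdifferentiable _) (mdifferentiable_const_smul I u x) rfl,
    comp_eq, logDerivL_conj_apply (h.mdifferentiable x)]

theorem logDerivL_fundamentalField (x : M) (X : GroupLieAlgebra I U) :
    logDerivL I J μ x (fundamentalField I J x X) = Ad I (μ x)⁻¹ X - X := by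
  have comp_eq : μ ∘ (fun u : U => u • x) = fun u => u * μ x * u⁻¹ :=
    funext fun u => h.equivariant u x
  have id_diff : MDifferentiableAt I I (fun u : U => u) 1 := mdifferentiableAt_id
  have mul_diff := mdifferentiable_mul_right (I := I) (μ x) 1
  have chain := logDerivL_comp_apply (h.mdifferentiable x) (mdifferentiable_orbit I J x 1)
    (one_smul U x) X
  refine chain.symm.trans ?_
  rw [comp_eq, logDerivL_mul_apply mul_diff (mdifferentiableAt_inv id_diff),
    logDerivL_inv_apply id_diff, logDerivL_mul_apply id_diff mdifferentiableAt_const]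
  simp [logDerivL_const, logDerivL_id_one, logDerivR_apply, Ad_one, sub_eq_add_neg]

theorem logDerivR_fundamentalField (x : M) (X : GroupLieAlgebra I U) :
    logDerivR I J μ x (fundamentalField I J x X) = X - Ad I (μ x) X := by
  have Ad_Ad_inv := Ad_inv_apply_Ad_apply (I := I) (μ x)⁻¹ X
  rw [inv_inv] at Ad_Ad_inv
  rw [logDerivR_apply, h.logDerivL_fundamentalField, map_sub, Ad_Ad_inv]

omit [LieGroup I 1 U] [ContMDiffSMul I J 1 U M] in
theorem form_smul_apply (u : U) (x : M) (v w : TangentSpace J x) :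
    Ω (u • x) ![mfderiv J J (fun y => u • y) x v, mfderiv J J (fun y => u • y) x w] =
      Ω x ![v, w] := by
  rw [← pullback_apply_two (fun y => u • y), h.invariant]

theorem form_fundamentalField_add_apply (x : M) (X Y : GroupLieAlgebra I U)
    (v w : TangentSpace J x) :
    Ω x ![fundamentalField I J x X + v, fundamentalField I J x Y + w] =
      Ω x ![v, w] + (1 / 2 : ℝ) * (B (Ad I (μ x)⁻¹ Y - Ad I (μ x) Y) X +
        B (logDerivL I J μ x w + logDerivR I J μ x w) X -
        B (logDerivL I J μ x v + logDerivR I J μ x v) Y) := by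
  rw [twoForm_add_add, h.momentum, h.momentum, h.momentum, h.logDerivL_fundamentalField,
    h.logDerivR_fundamentalField, sub_add_sub_cancel]
  ring

end IsGroupValuedMomentumMap

namespace IsReversingInvolution

variable {τ : U ≃* U} {β : M → M} (hβ : IsReversingInvolution J τ Ω μ β)
include hβ

omit [TopologicalSpace U] in
theorem mdifferentiable : MDifferentiable J J β :=
  hβ.smooth.mdifferentiable (by simp)

omit [TopologicalSpace U] in
theorem form_apply (x : M) (v w : TangentSpace J x) :
    Ω (β x) ![mfderiv J J β x v, mfderiv J J β x w] = -Ω x ![v, w] := by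
  rw [← pullback_apply_two, hβ.reverses]
  rfl

variable [LieGroup I 1 U] (hτ : MDifferentiable I I τ) (hμ : MDifferentiable J I μ)
include hτ hμ

theorem logDerivL_apply (x : M) (v : TangentSpace J x) :
    logDerivL I J μ (β x) (mfderiv J J β x v) = -tangentOne I τ (logDerivR I J μ x v) := by
  have comp_eq : μ ∘ β = fun z => τ ((μ z)⁻¹) := funext hβ.momentum
  rw [← logDerivL_comp_apply (hμ _) (hβ.mdifferentiable x) rfl, comp_eq,
    logDerivL_map_apply hτ (mdifferentiableAt_inv (hμ x)),
    logDerivL_inv_apply (hμ x), map_neg]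

theorem logDerivR_apply (x : M) (v : TangentSpace J x) :
    logDerivR I J μ (β x) (mfderiv J J β x v) = -tangentOne I τ (logDerivL I J μ x v) := by
  have comp_eq : μ ∘ β = fun z => τ ((μ z)⁻¹) := funext hβ.momentum
  rw [← logDerivR_comp_apply (hμ _) (hβ.mdifferentiable x), comp_eq,
    logDerivR_map_apply hτ (mdifferentiableAt_inv (hμ x)),
    logDerivR_inv_apply (hμ x), map_neg]

end IsReversingInvolution

end MomentumMap

section Fusion

variable {E : Type*} [NormedAddCommGroup E] [NormedSpace ℝ E]
  {H : Type*} [TopologicalSpace H] {I : ModelWithCorners ℝ E H}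
  {U : Type*} [TopologicalSpace U] [ChartedSpace H U] [Group U]
  {F₁ : Type*} [NormedAddCommGroup F₁] [NormedSpace ℝ F₁]
  {K₁ : Type*} [TopologicalSpace K₁] {J₁ : ModelWithCorners ℝ F₁ K₁}
  {M₁ : Type*} [TopologicalSpace M₁] [ChartedSpace K₁ M₁]
  {F₂ : Type*} [NormedAddCommGroup F₂] [NormedSpace ℝ F₂]
  {K₂ : Type*} [TopologicalSpace K₂] {J₂ : ModelWithCorners ℝ F₂ K₂}
  {M₂ : Type*} [TopologicalSpace M₂] [ChartedSpace K₂ M₂]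
  {B : GroupLieAlgebra I U →L[ℝ] GroupLieAlgebra I U →L[ℝ] ℝ}
  {Ω₁ : DiffForm J₁ M₁ 2} {μ₁ : M₁ → U} {Ω₂ : DiffForm J₂ M₂ 2} {μ₂ : M₂ → U}

variable (B Ω₁ μ₁ Ω₂ μ₂) in
theorem fusionForm_apply (p : M₁ × M₂) (v w : TangentSpace (J₁.prod J₂) p) :
    fusionForm I J₁ J₂ B Ω₁ μ₁ Ω₂ μ₂ p ![v, w] =
      Ω₁ p.1 ![mfderiv (J₁.prod J₂) J₁ Prod.fst p v, mfderiv (J₁.prod J₂) J₁ Prod.fst p w] +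
      Ω₂ p.2 ![mfderiv (J₁.prod J₂) J₂ Prod.snd p v, mfderiv (J₁.prod J₂) J₂ Prod.snd p w] +
      (1 / 2 : ℝ) *
        (B (logDerivL I J₁ μ₁ p.1 (mfderiv (J₁.prod J₂) J₁ Prod.fst p v))
            (logDerivR I J₂ μ₂ p.2 (mfderiv (J₁.prod J₂) J₂ Prod.snd p w)) -
          B (logDerivL I J₁ μ₁ p.1 (mfderiv (J₁.prod J₂) J₁ Prod.fst p w))
            (logDerivR I J₂ μ₂ p.2 (mfderiv (J₁.prod J₂) J₂ Prod.snd p v))) := by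
  rw [← pullback_apply_two, ← pullback_apply_two]
  rfl

/-- The braiding `M₂ × M₁ → M₁ × M₂` of two fusion factors, `(x₂, x₁) ↦ (μ₂(x₂) . x₁, x₂)`. -/
abbrev fusionBraiding [MulAction U M₁] (μ₂ : M₂ → U) : M₂ × M₁ → M₁ × M₂ :=
  fun q => (μ₂ q.1 • q.2, q.1)

section Braiding

variable [MulAction U M₁] [ContMDiffSMul I J₁ 1 U M₁] (hμ₂ : MDifferentiable J₂ I μ₂)
include hμ₂

theorem mdifferentiable_smul_momentum :
    MDifferentiable (J₂.prod J₁) J₁ (fun q : M₂ × M₁ => μ₂ q.1 • q.2) :=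
  mdifferentiable_smul.comp (I' := I.prod J₁)
    ((hμ₂.comp mdifferentiable_fst).prodMk mdifferentiable_snd)

theorem mdifferentiable_fusionBraiding :
    MDifferentiable (J₂.prod J₁) (J₁.prod J₂) (fusionBraiding (M₁ := M₁) μ₂) :=
  (mdifferentiable_smul_momentum hμ₂).prodMk mdifferentiable_fst

variable [LieGroup I 1 U]

theorem mfderiv_fst_mfderiv_fusionBraiding (q : M₂ × M₁) (v : TangentSpace (J₂.prod J₁) q) :
    mfderiv (J₁.prod J₂) J₁ Prod.fst (fusionBraiding μ₂ q)
        (mfderiv (J₂.prod J₁) (J₁.prod J₂) (fusionBraiding μ₂) q v) =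
      mfderiv J₁ J₁ (fun y => μ₂ q.1 • y) q.2
        (fundamentalField I J₁ q.2
            (logDerivL I J₂ μ₂ q.1 (mfderiv (J₂.prod J₁) J₂ Prod.fst q v)) +
          mfderiv (J₂.prod J₁) J₁ Prod.snd q v) := by
  have fst_diff : MDifferentiableAt (J₂.prod J₁) J₂ (Prod.fst : M₂ × M₁ → M₂) q :=
    mdifferentiableAt_fst
  have smul_deriv := mfderiv_smul_apply ((hμ₂ q.1).comp q fst_diff) mdifferentiableAt_snd v
  rw [mfderiv_comp_apply q (hμ₂ q.1) fst_diff, mfderiv_orbit_apply, ← map_add] at smul_deriv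
  exact (mfderiv_fst_mfderiv_prodMk (mdifferentiable_smul_momentum hμ₂ q) fst_diff v).trans
    smul_deriv

omit [LieGroup I 1 U] in
theorem mfderiv_snd_mfderiv_fusionBraiding (q : M₂ × M₁) (v : TangentSpace (J₂.prod J₁) q) :
    mfderiv (J₁.prod J₂) J₂ Prod.snd (fusionBraiding μ₂ q)
        (mfderiv (J₂.prod J₁) (J₁.prod J₂) (fusionBraiding μ₂) q v) =
      mfderiv (J₂.prod J₁) J₂ Prod.fst q v :=
  mfderiv_snd_mfderiv_prodMk (mdifferentiable_smul_momentum hμ₂ q) mdifferentiableAt_fst v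

theorem pullback_fusionBraiding_fusionForm (hsymm : ∀ X Y, B X Y = B Y X)
    (hAd : ∀ (u : U) (X Y), B (Ad I u X) (Ad I u Y) = B X Y)
    (h₁ : IsGroupValuedMomentumMap I J₁ B Ω₁ μ₁) :
    pullback (J₂.prod J₁) (J₁.prod J₂) (fusionBraiding μ₂) (fusionForm I J₁ J₂ B Ω₁ μ₁ Ω₂ μ₂) =
      fusionForm I J₂ J₁ B Ω₂ μ₂ Ω₁ μ₁ := by
  refine DiffForm.ext_two fun q v w => ?_
  have Ad_adjoint (X Y : GroupLieAlgebra I U) :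
      B (Ad I (μ₁ q.2)⁻¹ X) Y = B (Ad I (μ₁ q.2) Y) X := by
    rw [← hAd (μ₁ q.2)⁻¹ _ X, Ad_inv_apply_Ad_apply, hsymm]
  rw [pullback_apply_two, fusionForm_apply, fusionForm_apply,
    mfderiv_fst_mfderiv_fusionBraiding hμ₂, mfderiv_fst_mfderiv_fusionBraiding hμ₂,
    mfderiv_snd_mfderiv_fusionBraiding hμ₂, mfderiv_snd_mfderiv_fusionBraiding hμ₂]
  simp only [fusionBraiding]
  rw [h₁.form_smul_apply, h₁.form_fundamentalField_add_apply, h₁.logDerivL_smul_apply,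
    h₁.logDerivL_smul_apply, logDerivR_apply μ₂, logDerivR_apply μ₂, hAd, hAd]
  set X := logDerivL I J₂ μ₂ q.1 (mfderiv (J₂.prod J₁) J₂ Prod.fst q v)
  set Y := logDerivL I J₂ μ₂ q.1 (mfderiv (J₂.prod J₁) J₂ Prod.fst q w)
  -- The fundamental fields contribute `(Ad(μ₁)⁻¹ Y | X)` and `(Ad(μ₁) Y | X)`; they cancel against
  -- the values of the mixed part on fundamental fields.
  simp only [map_add, map_sub, add_apply, sub_apply, h₁.logDerivL_fundamentalField]
  rw [Ad_adjoint X Y, hsymm Y X, hsymm X (logDerivR I J₁ _ _ _),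
    hsymm Y (logDerivR I J₁ _ _ _)]
  ring

end Braiding

section Reversal

variable [LieGroup I 1 U] [MulAction U M₁] [MulAction U M₂] {τ : U ≃* U} {β₁ : M₁ → M₁}
  {β₂ : M₂ → M₂}

theorem pullback_swap_fusionForm (hsymm : ∀ X Y, B X Y = B Y X)
    (hτ : IsInvolutiveAutomorphism I B τ) (hμ₁ : MDifferentiable J₁ I μ₁)
    (hμ₂ : MDifferentiable J₂ I μ₂) (hβ₁ : IsReversingInvolution J₁ τ Ω₁ μ₁ β₁)
    (hβ₂ : IsReversingInvolution J₂ τ Ω₂ μ₂ β₂) :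
    pullback (J₁.prod J₂) (J₂.prod J₁) (fun p => (β₂ p.2, β₁ p.1))
      (fusionForm I J₂ J₁ B Ω₂ μ₂ Ω₁ μ₁) = -fusionForm I J₁ J₂ B Ω₁ μ₁ Ω₂ μ₂ := by
  have τ_diff : MDifferentiable I I τ := hτ.smooth.mdifferentiable (by simp)
  refine DiffForm.ext_two fun p v w => ?_
  have fst_deriv (u : TangentSpace (J₁.prod J₂) p) :=
    (mfderiv_fst_mfderiv_prodMk (hβ₂.mdifferentiable.comp mdifferentiable_snd p)
      (hβ₁.mdifferentiable.comp mdifferentiable_fst p) u).trans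
    (mfderiv_comp_apply p (hβ₂.mdifferentiable p.2) mdifferentiableAt_snd u)
  have snd_deriv (u : TangentSpace (J₁.prod J₂) p) :=
    (mfderiv_snd_mfderiv_prodMk (hβ₂.mdifferentiable.comp mdifferentiable_snd p)
      (hβ₁.mdifferentiable.comp mdifferentiable_fst p) u).trans
    (mfderiv_comp_apply p (hβ₁.mdifferentiable p.1) mdifferentiableAt_fst u)
  simp only [Function.comp_apply] at fst_deriv snd_deriv
  rw [pullback_apply_two, fusionForm_apply, fst_deriv, fst_deriv, snd_deriv, snd_deriv]
  simp only
  rw [hβ₁.form_apply, hβ₂.form_apply, hβ₂.logDerivL_apply τ_diff hμ₂,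
    hβ₂.logDerivL_apply τ_diff hμ₂, hβ₁.logDerivR_apply τ_diff hμ₁,
    hβ₁.logDerivR_apply τ_diff hμ₁, Pi.neg_apply,
    ContinuousAlternatingMap.neg_apply, fusionForm_apply]
  simp only [map_neg, neg_apply, neg_neg, hτ.isometry]
  rw [hsymm (logDerivR I J₂ _ _ _), hsymm (logDerivR I J₂ _ _ _)]
  ring

end Reversal

end Fusion

end QuasiHam

end

theorem lemma6p12_general
    {E : Type*} [NormedAddCommGroup E] [NormedSpace ℝ E]
    {H : Type*} [TopologicalSpace H] (I : ModelWithCorners ℝ E H)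
    {U : Type*} [TopologicalSpace U] [ChartedSpace H U] [Group U] [LieGroup I ∞ U]
    {F₁ : Type*} [NormedAddCommGroup F₁] [NormedSpace ℝ F₁]
    {K₁ : Type*} [TopologicalSpace K₁] (J₁ : ModelWithCorners ℝ F₁ K₁)
    {M₁ : Type*} [TopologicalSpace M₁] [ChartedSpace K₁ M₁] [MulAction U M₁]
    [ContMDiffSMul I J₁ ∞ U M₁]
    {F₂ : Type*} [NormedAddCommGroup F₂] [NormedSpace ℝ F₂]
    {K₂ : Type*} [TopologicalSpace K₂] (J₂ : ModelWithCorners ℝ F₂ K₂)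
    {M₂ : Type*} [TopologicalSpace M₂] [ChartedSpace K₂ M₂] [MulAction U M₂]
    (B : GroupLieAlgebra I U →L[ℝ] GroupLieAlgebra I U →L[ℝ] ℝ)
    (hsymm : ∀ X Y, B X Y = B Y X)
    (hAd : ∀ (u : U) (X Y), B (QuasiHam.Ad I u X) (QuasiHam.Ad I u Y) = B X Y)
    (Ω₁ : QuasiHam.DiffForm J₁ M₁ 2) (μ₁ : M₁ → U)
    (h₁ : QuasiHam.IsGroupValuedMomentumMap I J₁ B Ω₁ μ₁)
    (Ω₂ : QuasiHam.DiffForm J₂ M₂ 2) (μ₂ : M₂ → U)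
    (hμ₂ : ContMDiff J₂ I ∞ μ₂) (hμ₂_equivariant : ∀ (u : U) (x : M₂), μ₂ (u • x) = u * μ₂ x * u⁻¹)
    (τ : U ≃* U) (hτ : QuasiHam.IsInvolutiveAutomorphism I B τ)
    (β₁ : M₁ → M₁) (hβ₁ : QuasiHam.IsReversingInvolution J₁ τ Ω₁ μ₁ β₁)
    (β₂ : M₂ → M₂) (hβ₂ : QuasiHam.IsReversingInvolution J₂ τ Ω₂ μ₂ β₂) :
    QuasiHam.IsReversingInvolution (J₁.prod J₂) τ
      (QuasiHam.fusionForm I J₁ J₂ B Ω₁ μ₁ Ω₂ μ₂)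
      (QuasiHam.fusionMomentum μ₁ μ₂)
      (QuasiHam.fusionInvolution μ₂ β₁ β₂) where
  smooth := ((hμ₂.comp (hβ₂.smooth.comp contMDiff_snd)).smul
    (hβ₁.smooth.comp contMDiff_fst)).prodMk (hβ₂.smooth.comp contMDiff_snd)
  involutive p := by
    simp [QuasiHam.fusionInvolution, hβ₁.action, hβ₂.momentum, hβ₁.involutive, hβ₂.involutive,
      hτ.involutive]
  reverses := by
    have factorization : QuasiHam.fusionInvolution μ₂ β₁ β₂ =
        QuasiHam.fusionBraiding μ₂ ∘ (fun p => (β₂ p.2, β₁ p.1)) := rfl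
    have μ₂_diff : MDifferentiable J₂ I μ₂ := hμ₂.mdifferentiable (by simp)
    have swap_diff : MDifferentiable (J₁.prod J₂) (J₂.prod J₁)
        (fun p : M₁ × M₂ => (β₂ p.2, β₁ p.1)) :=
      (hβ₂.mdifferentiable.comp mdifferentiable_snd).prodMk
        (hβ₁.mdifferentiable.comp mdifferentiable_fst)
    rw [factorization,
      QuasiHam.pullback_comp (QuasiHam.mdifferentiable_fusionBraiding μ₂_diff) swap_diff,
      QuasiHam.pullback_fusionBraiding_fusionForm μ₂_diff hsymm hAd h₁,
      QuasiHam.pullback_swap_fusionForm hsymm hτ h₁.mdifferentiable μ₂_diff hβ₁ hβ₂]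
  action u p := by
    simp [QuasiHam.fusionInvolution, hβ₁.action, hβ₂.action, hμ₂_equivariant, smul_smul]
  momentum p := by
    simp [QuasiHam.fusionInvolution, QuasiHam.fusionMomentum, h₁.equivariant, hβ₁.momentum,
      hβ₂.momentum]

theorem lemma6p12
    {E : Type*} [NormedAddCommGroup E] [NormedSpace ℝ E] [FiniteDimensional ℝ E]
    {H : Type*} [TopologicalSpace H] (I : ModelWithCorners ℝ E H)
    {U : Type*} [TopologicalSpace U] [ChartedSpace H U] [Group U] [LieGroup I ∞ U]
    [BoundarylessManifold I U] [T2Space U] [CompactSpace U] [ConnectedSpace U]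
    {F₁ : Type*} [NormedAddCommGroup F₁] [NormedSpace ℝ F₁] [FiniteDimensional ℝ F₁]
    {K₁ : Type*} [TopologicalSpace K₁] (J₁ : ModelWithCorners ℝ F₁ K₁)
    {M₁ : Type*} [TopologicalSpace M₁] [ChartedSpace K₁ M₁] [IsManifold J₁ ∞ M₁]
    [BoundarylessManifold J₁ M₁] [MulAction U M₁] [ContMDiffSMul I J₁ ∞ U M₁]
    {F₂ : Type*} [NormedAddCommGroup F₂] [NormedSpace ℝ F₂] [FiniteDimensional ℝ F₂]
    {K₂ : Type*} [TopologicalSpace K₂] (J₂ : ModelWithCorners ℝ F₂ K₂)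
    {M₂ : Type*} [TopologicalSpace M₂] [ChartedSpace K₂ M₂] [IsManifold J₂ ∞ M₂]
    [BoundarylessManifold J₂ M₂] [MulAction U M₂] [ContMDiffSMul I J₂ ∞ U M₂]
    (B : GroupLieAlgebra I U →L[ℝ] GroupLieAlgebra I U →L[ℝ] ℝ)
    (hB : QuasiHam.IsAdInvariantEuclidean I B)
    (Ω₁ : QuasiHam.DiffForm J₁ M₁ 2) (μ₁ : M₁ → U)
    (h₁ : QuasiHam.IsQuasiHamiltonian I J₁ B Ω₁ μ₁)
    (Ω₂ : QuasiHam.DiffForm J₂ M₂ 2) (μ₂ : M₂ → U)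
    (h₂ : QuasiHam.IsQuasiHamiltonian I J₂ B Ω₂ μ₂)
    (τ : U ≃* U) (hτ : QuasiHam.IsInvolutiveAutomorphism I B τ)
    (β₁ : M₁ → M₁) (hβ₁ : QuasiHam.IsReversingInvolution J₁ τ Ω₁ μ₁ β₁)
    (β₂ : M₂ → M₂) (hβ₂ : QuasiHam.IsReversingInvolution J₂ τ Ω₂ μ₂ β₂) :
    QuasiHam.IsReversingInvolution (J₁.prod J₂) τ
      (QuasiHam.fusionForm I J₁ J₂ B Ω₁ μ₁ Ω₂ μ₂)
      (QuasiHam.fusionMomentum μ₁ μ₂)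
      (QuasiHam.fusionInvolution μ₂ β₁ β₂) :=
  lemma6p12_general I J₁ J₂ B hB.symm hB.ad_invariant Ω₁ μ₁ h₁.isGroupValuedMomentumMap Ω₂ μ₂
    h₂.smooth_momentum h₂.equivariant τ hτ β₁ hβ₁ β₂ hβ₂
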